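/- Let $G$ be a finite, simple, undirected, connected graph with $n\ge 2$ vertices and $m$ edges. Let $A(G)$ be its adjacency matrix, $D(G)$ its diagonal degree matrix, $L(G)=D(G)-A(G)$ its Laplacian, and, for real $\alpha$ with $\tfrac12\le\alpha<1$, let $A_\alpha(G)=\alpha D(G)+(1-\alpha)A(G)$. Denote the eigenvalues (with multiplicity) of $A(G)$, $L(G)$, $A_\alpha(G)$ by $\gamma_i$, $\mu_i$, $\rho_i$ ($1\le i\le n$), respectively, and put $$\mathfrak{E}(G)=\sum_{i=1}^n|\gamma_i|,\qquad E_L(G)=\sum_{i=1}^n\Big|\mu_i-\frac{2m}{n}\Big|,\qquad E_{A_\alpha}(G)=\sum_{i=1}^n\Big|\rho_i-\frac{2\alpha m}{n}\Big|.$$ Let $\zeta$ be the rank of $A(G)$ over $\mathbb{R}$. Then $$E_{A_\alpha}(G)+\alpha E_L(G)\ \ge\ 2\,\mathfrak{E}(G)-\frac{4\alpha m\zeta}{n}.$$ Equality holds if and only if $\alpha=\tfrac12$, $n$ is even, and $G$ is isomorphic to the complete bipartite graph $K_{\frac n2,\frac n2}$. -/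

import Mathlib

noncomputable section

namespace GraphEnergy

theorem isHermitian_adjMatrix {V : Type*} (G : SimpleGraph V) [DecidableRel G.Adj] :
    (G.adjMatrix ℝ).IsHermitian :=
  Matrix.isHermitian_iff_isSymm.mpr (G.isSymm_adjMatrix)

variable {V : Type*} [Fintype V] [DecidableEq V] (G : SimpleGraph V) [DecidableRel G.Adj]

/-- The matrix `A_α(G) = α D(G) + (1 - α) A(G)`. -/
def aAlphaMatrix (α : ℝ) : Matrix V V ℝ :=
  α • G.degMatrix ℝ + (1 - α) • G.adjMatrix ℝ

theorem isHermitian_lapMatrix : (G.lapMatrix ℝ).IsHermitian :=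
  Matrix.isHermitian_iff_isSymm.mpr (G.isSymm_lapMatrix (R := ℝ))

theorem isHermitian_aAlphaMatrix (α : ℝ) : (aAlphaMatrix G α).IsHermitian :=
  Matrix.isHermitian_iff_isSymm.mpr
    (((G.isSymm_degMatrix (R := ℝ)).smul α).add ((G.isSymm_adjMatrix).smul (1 - α)))

/-- The energy `∑ |γᵢ|`, with `γᵢ` the eigenvalues of the adjacency matrix, counted with
multiplicity. -/
def adjEnergy : ℝ :=
  ∑ i, |(isHermitian_adjMatrix G).eigenvalues i|

/-- The Laplacian energy `∑ |μᵢ - 2m/n|`, with `μᵢ` the eigenvalues of the Laplacian matrix,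
counted with multiplicity. -/
def lapEnergy : ℝ :=
  ∑ i, |(isHermitian_lapMatrix G).eigenvalues i
    - 2 * (G.edgeFinset.card : ℝ) / (Fintype.card V : ℝ)|

/-- The `A_α`-energy `∑ |ρᵢ - 2αm/n|`, with `ρᵢ` the eigenvalues of `A_α(G)`, counted with
multiplicity. -/
def aAlphaEnergy (α : ℝ) : ℝ :=
  ∑ i, |(isHermitian_aAlphaMatrix G α).eigenvalues i
    - 2 * α * (G.edgeFinset.card : ℝ) / (Fintype.card V : ℝ)|

end GraphEnergy

end

/-! Since `A_α = A + αL`, test both matrices on an orthonormal eigenbasis of `A`. A weak Ky Fan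
inequality (`two_mul_sum_le_sum_abs`) bounds the `A_α`-energy below using the eigenvectors of
positive eigenvalue, and the Laplacian energy using those of negative eigenvalue. The eigenvalue
terms add up to twice the adjacency energy, and the subtracted means, one per nonzero eigenvalue,
give the rank term. What remains are values of the quadratic forms of `L` and `A_α`, both positive
semidefinite when `1/2 ≤ α < 1`.

Equality makes these values vanish. Positive eigenvectors are then constant, while negative ones
change sign across each edge and force `α = 1/2`. The spectral decomposition becomes `A = (J - s
sᵀ)/2` for a balanced sign vector `s`, that is, `K_{n/2,n/2}`. Conversely, for that graph all three
centred matrices are multiples of `A`, and `A³ = (n/2)² A`, so traces of squares give the energies.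
-/

/-! ### Spectral tools for real Hermitian matrices. -/

namespace Matrix.IsHermitian

variable {V : Type*} [Fintype V] [DecidableEq V] {M : Matrix V V ℝ}

/-- The orthonormal eigenvectors of a real Hermitian matrix, as plain functions. -/
noncomputable def eigenvec (hM : M.IsHermitian) (k : V) : V → ℝ := ⇑(hM.eigenvectorBasis k)

theorem mulVec_eigenvec (hM : M.IsHermitian) (k : V) :
    M *ᵥ hM.eigenvec k = hM.eigenvalues k • hM.eigenvec k :=
  hM.mulVec_eigenvectorBasis k

theorem eigenvec_dotProduct (hM : M.IsHermitian) (k l : V) :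
    hM.eigenvec k ⬝ᵥ hM.eigenvec l = if k = l then 1 else 0 := by
  have h := orthonormal_iff_ite.mp hM.eigenvectorBasis.orthonormal l k
  rw [EuclideanSpace.inner_eq_star_dotProduct] at h
  simpa [eigenvec, eq_comm] using h

theorem eigenvec_ne_zero (hM : M.IsHermitian) (k : V) : hM.eigenvec k ≠ 0 := by
  intro h
  have := hM.eigenvec_dotProduct k k
  simp [h] at this

theorem sum_eigenvec_mul (hM : M.IsHermitian) (i j : V) :
    ∑ k, hM.eigenvec k i * hM.eigenvec k j = if i = j then 1 else 0 := by
  have h : (hM.eigenvectorUnitary : Matrix V V ℝ) *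
      star (hM.eigenvectorUnitary : Matrix V V ℝ) = 1 :=
    Unitary.mul_star_self_of_mem hM.eigenvectorUnitary.2
  have := congrFun (congrFun h i) j
  simpa [Matrix.mul_apply, Matrix.one_apply, star_apply, eigenvec] using this

theorem apply_eq_sum_eigenvalues (hM : M.IsHermitian) (i j : V) :
    M i j = ∑ k, hM.eigenvalues k * (hM.eigenvec k i * hM.eigenvec k j) := by
  have h : ∀ k, hM.eigenvalues k * hM.eigenvec k i = ∑ l, M i l * hM.eigenvec k l := fun k => by
    simpa [mulVec, dotProduct] using (congrFun (hM.mulVec_eigenvec k) i).symm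
  simp_rw [← mul_assoc, h, Finset.sum_mul, mul_assoc]
  rw [Finset.sum_comm]
  simp_rw [← Finset.mul_sum, sum_eigenvec_mul]
  simp

/-- The trace is the sum of the diagonal entries in any orthonormal eigenbasis. -/
theorem trace_eq_sum_eigenvec (hM : M.IsHermitian) (N : Matrix V V ℝ) :
    N.trace = ∑ k, hM.eigenvec k ⬝ᵥ N *ᵥ hM.eigenvec k := by
  simp only [dotProduct, mulVec, Finset.mul_sum]
  rw [Finset.sum_comm_cycle, Finset.sum_comm_cycle]
  have h : ∀ i j, ∑ k, hM.eigenvec k i * (N i j * hM.eigenvec k j)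
      = N i j * if i = j then 1 else 0 := by
    intro i j
    rw [← hM.sum_eigenvec_mul, Finset.mul_sum]
    exact Finset.sum_congr rfl fun _ _ => by ring
  simp_rw [h]
  simp [trace]

theorem dotProduct_mulVec_eq_sum (hM : M.IsHermitian) (v : V → ℝ) :
    v ⬝ᵥ M *ᵥ v = ∑ k, hM.eigenvalues k * (hM.eigenvec k ⬝ᵥ v) ^ 2 := by
  simp only [dotProduct, mulVec, sq, Finset.sum_mul_sum]
  simp_rw [hM.apply_eq_sum_eigenvalues, Finset.mul_sum, Finset.sum_mul, Finset.mul_sum]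
  rw [Finset.sum_comm_cycle]
  refine Finset.sum_congr rfl fun _ _ => ?_
  rw [Finset.sum_comm]
  exact Finset.sum_congr rfl fun _ _ => Finset.sum_congr rfl fun _ _ => by ring

theorem dotProduct_self_eq_sum (hM : M.IsHermitian) (v : V → ℝ) :
    v ⬝ᵥ v = ∑ k, (hM.eigenvec k ⬝ᵥ v) ^ 2 := by
  simp only [dotProduct, sq, Finset.sum_mul_sum]
  rw [Finset.sum_comm_cycle, Finset.sum_comm_cycle]
  have h : ∀ i j, ∑ k, hM.eigenvec k i * v i * (hM.eigenvec k j * v j)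
      = (v i * v j) * if i = j then 1 else 0 := by
    intro i j
    rw [← hM.sum_eigenvec_mul, Finset.mul_sum]
    exact Finset.sum_congr rfl fun _ _ => by ring
  simp_rw [h]
  simp

/-- A weak form of Ky Fan's inequality: if the eigenvalues of `M` have mean `c`, then twice the sum
of `vᵀ M v - c` over finitely many members `v` of an orthonormal eigenbasis is at most
`∑ |λᵢ - c|`. -/
theorem two_mul_sum_le_sum_abs {A : Matrix V V ℝ} (hM : M.IsHermitian) (hA : A.IsHermitian)
    (c : ℝ) (hc : M.trace = Fintype.card V * c) (s : Finset V) :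
    2 * ∑ j ∈ s, (hA.eigenvec j ⬝ᵥ M *ᵥ hA.eigenvec j - c) ≤ ∑ k, |hM.eigenvalues k - c| := by
  have hsum : ∑ k, (hM.eigenvalues k - c) = 0 := by
    have := hM.trace_eq_sum_eigenvalues
    simp only [RCLike.ofReal_real_eq_id, id] at this
    rw [Finset.sum_sub_distrib, ← this, hc]
    simp
  have hbess : ∀ k, ∑ j ∈ s, (hM.eigenvec k ⬝ᵥ hA.eigenvec j) ^ 2 ≤ 1 := by
    intro k
    have h1 := hA.dotProduct_self_eq_sum (hM.eigenvec k)
    rw [hM.eigenvec_dotProduct, if_pos rfl] at h1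
    rw [h1]
    simp_rw [dotProduct_comm (hM.eigenvec k)]
    exact Finset.sum_le_sum_of_subset_of_nonneg (Finset.subset_univ s) fun _ _ _ => sq_nonneg _
  have hq : ∀ j, hA.eigenvec j ⬝ᵥ M *ᵥ hA.eigenvec j - c
      = ∑ k, (hM.eigenvalues k - c) * (hM.eigenvec k ⬝ᵥ hA.eigenvec j) ^ 2 := by
    intro j
    have h1 := hM.dotProduct_self_eq_sum (hA.eigenvec j)
    rw [hA.eigenvec_dotProduct, if_pos rfl] at h1
    simp_rw [sub_mul, Finset.sum_sub_distrib, ← Finset.mul_sum, ← h1, mul_one,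
      hM.dotProduct_mulVec_eq_sum]
  simp_rw [hq]
  rw [Finset.sum_comm]
  simp_rw [← Finset.mul_sum]
  -- By Bessel the weight lies in `[0, 1]`, and `2xw ≤ |x| + x` for such `w`. The extra `x` sums to
  -- zero by the trace condition.
  have hle : ∀ k, 2 * ((hM.eigenvalues k - c) * ∑ j ∈ s, (hM.eigenvec k ⬝ᵥ hA.eigenvec j) ^ 2)
      ≤ |hM.eigenvalues k - c| + (hM.eigenvalues k - c) := by
    intro k
    have h0 : 0 ≤ ∑ j ∈ s, (hM.eigenvec k ⬝ᵥ hA.eigenvec j) ^ 2 :=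
      Finset.sum_nonneg fun _ _ => sq_nonneg _
    rcases abs_cases (hM.eigenvalues k - c) with ⟨h, h'⟩ | ⟨h, h'⟩ <;> rw [h] <;>
      nlinarith [hbess k]
  calc _ = ∑ k, 2 * ((hM.eigenvalues k - c) *
            ∑ j ∈ s, (hM.eigenvec k ⬝ᵥ hA.eigenvec j) ^ 2) := by rw [Finset.mul_sum]
    _ ≤ ∑ k, (|hM.eigenvalues k - c| + (hM.eigenvalues k - c)) :=
        Finset.sum_le_sum fun k _ => hle k
    _ = _ := by rw [Finset.sum_add_distrib, hsum, add_zero]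

theorem sum_sq_eigenvalues_sub (hM : M.IsHermitian) (c : ℝ) :
    ∑ k, (hM.eigenvalues k - c) ^ 2 = ((M - c • 1) * (M - c • 1)).trace := by
  rw [hM.trace_eq_sum_eigenvec]
  refine Finset.sum_congr rfl fun k _ => ?_
  have h : (M - c • (1 : Matrix V V ℝ)) *ᵥ hM.eigenvec k
      = (hM.eigenvalues k - c) • hM.eigenvec k := by
    rw [sub_mulVec, mulVec_eigenvec, smul_mulVec, one_mulVec, sub_smul]
  rw [← mulVec_mulVec, h, mulVec_smul, h, smul_smul, dotProduct_smul, eigenvec_dotProduct]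
  simp [sq]

theorem eigenvalues_sub_cube (hM : M.IsHermitian) {c t : ℝ}
    (h3 : (M - c • 1) * ((M - c • 1) * (M - c • 1)) = t ^ 2 • (M - c • 1)) (k : V) :
    (hM.eigenvalues k - c) ^ 3 = t ^ 2 * (hM.eigenvalues k - c) := by
  have h : (M - c • (1 : Matrix V V ℝ)) *ᵥ hM.eigenvec k
      = (hM.eigenvalues k - c) • hM.eigenvec k := by
    rw [sub_mulVec, mulVec_eigenvec, smul_mulVec, one_mulVec, sub_smul]
  have := congrArg (hM.eigenvec k ⬝ᵥ · *ᵥ hM.eigenvec k) h3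
  simp only [← mulVec_mulVec, h, mulVec_smul, smul_mulVec, dotProduct_smul,
    eigenvec_dotProduct, smul_eq_mul, if_true, mul_one] at this
  rw [← this]; ring

/-- If `M - c` has its spectrum in `{-t, 0, t}`, then `∑ |λᵢ - c| = tr (M - c)² / t`. -/
theorem sum_abs_eigenvalues_sub (hM : M.IsHermitian) {c t : ℝ} (ht : 0 < t)
    (h3 : (M - c • 1) * ((M - c • 1) * (M - c • 1)) = t ^ 2 • (M - c • 1)) :
    ∑ k, |hM.eigenvalues k - c| = ((M - c • 1) * (M - c • 1)).trace / t := by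
  rw [← hM.sum_sq_eigenvalues_sub, Finset.sum_div]
  refine Finset.sum_congr rfl fun k _ => ?_
  have h := hM.eigenvalues_sub_cube h3 k
  rw [eq_div_iff ht.ne']
  by_cases h0 : hM.eigenvalues k - c = 0
  · simp [h0]
  · have h2 : (hM.eigenvalues k - c) ^ 2 = t ^ 2 :=
      mul_right_cancel₀ h0 (by rw [← h]; ring)
    have := (sq_eq_sq_iff_abs_eq_abs _ _).mp h2
    rw [abs_of_pos ht] at this
    rw [this, h2, sq]

/-- If a Hermitian matrix has its spectrum in `{-t, 0, t}`, then its rank is `tr M² / t²`. -/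
theorem rank_eq_trace_sq_div (hM : M.IsHermitian) {t : ℝ} (ht : 0 < t)
    (h3 : M * (M * M) = t ^ 2 • M) : (M.rank : ℝ) = (M * M).trace / t ^ 2 := by
  have hs := hM.sum_sq_eigenvalues_sub 0
  simp only [sub_zero, zero_smul] at hs
  rw [← hs, Finset.sum_div, hM.rank_eq_card_non_zero_eigs, Fintype.card_subtype,
    Finset.card_filter]
  push_cast
  refine Finset.sum_congr rfl fun k _ => ?_
  have h := hM.eigenvalues_sub_cube (c := 0) (t := t) (by simpa using h3) k
  rw [sub_zero] at h
  by_cases h0 : hM.eigenvalues k = 0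
  · simp [h0]
  · have h2 : (hM.eigenvalues k) ^ 2 = t ^ 2 :=
      mul_right_cancel₀ h0 (by rw [← h]; ring)
    simp [h0, h2, ht.ne']

end Matrix.IsHermitian

/-! ### Quadratic forms and the lower bound. -/

namespace GraphEnergy

open Matrix

variable {V : Type*} [Fintype V] (G : SimpleGraph V) [DecidableRel G.Adj]

theorem sum_sum_adj_sq_nonneg (v : V → ℝ) :
    0 ≤ (∑ i, ∑ j, if G.Adj i j then (v i + v j) ^ 2 else 0) / 2 := by
  refine div_nonneg (Finset.sum_nonneg fun i _ => Finset.sum_nonneg fun j _ => ?_) two_pos.le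
  split_ifs <;> positivity

theorem sum_degree_mul_sq_nonneg (v : V → ℝ) : 0 ≤ ∑ i, (G.degree i : ℝ) * v i ^ 2 :=
  Finset.sum_nonneg fun i _ => by positivity

variable [DecidableEq V]

theorem dotProduct_lapMatrix_mulVec (v : V → ℝ) :
    v ⬝ᵥ G.lapMatrix ℝ *ᵥ v = (∑ i, ∑ j, if G.Adj i j then (v i - v j) ^ 2 else 0) / 2 := by
  rw [← G.lapMatrix_toLinearMap₂' ℝ v, toLinearMap₂'_apply']

theorem sum_sum_adj_sq (v : V → ℝ) :
    (∑ i, ∑ j, if G.Adj i j then (v i + v j) ^ 2 else 0) / 2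
      = 2 * (v ⬝ᵥ G.degMatrix ℝ *ᵥ v) - v ⬝ᵥ G.lapMatrix ℝ *ᵥ v := by
  rw [dotProduct_lapMatrix_mulVec, SimpleGraph.dotProduct_mulVec_degMatrix]
  have h1 : ∑ i, (G.degree i : ℝ) * v i * v i = ∑ i, ∑ j, if G.Adj i j then v i ^ 2 else 0 := by
    refine Finset.sum_congr rfl fun i _ => ?_
    rw [G.degree_eq_sum_if_adj, Finset.sum_mul, Finset.sum_mul]
    exact Finset.sum_congr rfl fun j _ => by split_ifs <;> ring
  have h2 : ∑ i, (G.degree i : ℝ) * v i * v i = ∑ i, ∑ j, if G.Adj i j then v j ^ 2 else 0 := by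
    rw [h1, Finset.sum_comm]
    simp_rw [G.adj_comm]
  have h3 : (∑ i, ∑ j, if G.Adj i j then (v i + v j) ^ 2 else 0)
      + (∑ i, ∑ j, if G.Adj i j then (v i - v j) ^ 2 else 0)
      = 2 * (∑ i, ∑ j, if G.Adj i j then v i ^ 2 else 0)
        + 2 * (∑ i, ∑ j, if G.Adj i j then v j ^ 2 else 0) := by
    simp_rw [Finset.mul_sum, ← Finset.sum_add_distrib]
    exact Finset.sum_congr rfl fun i _ => Finset.sum_congr rfl fun j _ => by
      split_ifs <;> ring
  rw [← h1, ← h2] at h3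
  linarith

/-- `A_α = (2α - 1) D + (1 - α)(D + A)`, and the signless Laplacian `D + A` has the sum of `(vᵢ +
vⱼ)²` over edges as its form. This is where `α ≥ 1/2` gives semidefiniteness. -/
theorem dotProduct_aAlphaMatrix_mulVec (α : ℝ) (v : V → ℝ) :
    v ⬝ᵥ aAlphaMatrix G α *ᵥ v = (2 * α - 1) * ∑ i, G.degree i * v i ^ 2
      + (1 - α) * ((∑ i, ∑ j, if G.Adj i j then (v i + v j) ^ 2 else 0) / 2) := by
  have h : ∑ i, (G.degree i : ℝ) * v i ^ 2 = v ⬝ᵥ G.degMatrix ℝ *ᵥ v := by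
    rw [SimpleGraph.dotProduct_mulVec_degMatrix]
    exact Finset.sum_congr rfl fun _ _ => by ring
  rw [sum_sum_adj_sq, h, aAlphaMatrix, SimpleGraph.lapMatrix]
  simp only [add_mulVec, sub_mulVec, smul_mulVec, dotProduct_add, dotProduct_sub, dotProduct_smul,
    smul_eq_mul]
  ring

theorem dotProduct_aAlphaMatrix_eq_add (α : ℝ) (v : V → ℝ) :
    v ⬝ᵥ aAlphaMatrix G α *ᵥ v
      = v ⬝ᵥ G.adjMatrix ℝ *ᵥ v + α * (v ⬝ᵥ G.lapMatrix ℝ *ᵥ v) := by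
  rw [aAlphaMatrix, SimpleGraph.lapMatrix]
  simp only [add_mulVec, sub_mulVec, smul_mulVec, dotProduct_add, dotProduct_sub, dotProduct_smul,
    smul_eq_mul]
  ring

theorem dotProduct_lapMatrix_mulVec_nonneg (v : V → ℝ) : 0 ≤ v ⬝ᵥ G.lapMatrix ℝ *ᵥ v := by
  rw [dotProduct_lapMatrix_mulVec]
  refine div_nonneg (Finset.sum_nonneg fun i _ => Finset.sum_nonneg fun j _ => ?_) two_pos.le
  split_ifs <;> positivity

theorem dotProduct_aAlphaMatrix_mulVec_nonneg {α : ℝ} (hα : 1 / 2 ≤ α) (hα' : α < 1) (v : V → ℝ) :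
    0 ≤ v ⬝ᵥ aAlphaMatrix G α *ᵥ v := by
  rw [dotProduct_aAlphaMatrix_mulVec]
  exact add_nonneg (mul_nonneg (by linarith) (sum_degree_mul_sq_nonneg G v))
    (mul_nonneg (by linarith) (sum_sum_adj_sq_nonneg G v))

theorem trace_degMatrix : (G.degMatrix ℝ).trace = 2 * (G.edgeFinset.card : ℝ) := by
  rw [SimpleGraph.degMatrix, trace_diagonal]
  exact_mod_cast G.sum_degrees_eq_twice_card_edges

/-- The lower bound together with the two nonnegative terms that it discards. -/
theorem two_mul_adjEnergy_add_le [Nonempty V] {α : ℝ} (hα : 0 ≤ α) :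
    2 * adjEnergy G
        - 4 * α * (G.edgeFinset.card : ℝ) * ((G.adjMatrix ℝ).rank : ℝ) / (Fintype.card V : ℝ)
        + 2 * α * ∑ k with 0 < (isHermitian_adjMatrix G).eigenvalues k,
            (isHermitian_adjMatrix G).eigenvec k ⬝ᵥ
              G.lapMatrix ℝ *ᵥ (isHermitian_adjMatrix G).eigenvec k
        + 2 * ∑ k with (isHermitian_adjMatrix G).eigenvalues k < 0,
            (isHermitian_adjMatrix G).eigenvec k ⬝ᵥ
              aAlphaMatrix G α *ᵥ (isHermitian_adjMatrix G).eigenvec k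
      ≤ aAlphaEnergy G α + α * lapEnergy G := by
  have hn : (Fintype.card V : ℝ) ≠ 0 := by simp
  set hA := isHermitian_adjMatrix G
  have h1 := (isHermitian_aAlphaMatrix G α).two_mul_sum_le_sum_abs hA
    (2 * α * (G.edgeFinset.card : ℝ) / (Fintype.card V : ℝ)) (by
      rw [aAlphaMatrix, trace_add, trace_smul, trace_smul, trace_degMatrix,
        SimpleGraph.trace_adjMatrix]
      rw [mul_div_cancel₀ _ hn, smul_zero, add_zero, smul_eq_mul]
      ring) {k | 0 < hA.eigenvalues k}
  have h2 := (isHermitian_lapMatrix G).two_mul_sum_le_sum_abs hA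
    (2 * (G.edgeFinset.card : ℝ) / (Fintype.card V : ℝ)) (by
      rw [SimpleGraph.lapMatrix, trace_sub, trace_degMatrix, SimpleGraph.trace_adjMatrix]
      field_simp; simp) {k | hA.eigenvalues k < 0}
  have hq : ∀ k, hA.eigenvec k ⬝ᵥ G.adjMatrix ℝ *ᵥ hA.eigenvec k = hA.eigenvalues k := fun k => by
    rw [hA.mulVec_eigenvec, dotProduct_smul, hA.eigenvec_dotProduct]; simp
  have hrank : ((G.adjMatrix ℝ).rank : ℝ) = (Finset.card {k | 0 < hA.eigenvalues k} : ℝ)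
      + (Finset.card {k | hA.eigenvalues k < 0} : ℝ) := by
    rw [hA.rank_eq_card_non_zero_eigs, Fintype.card_subtype, ← Nat.cast_add,
      ← Finset.card_union_of_disjoint]
    · congr 2
      ext k
      simp only [Finset.mem_filter, Finset.mem_univ, true_and, Finset.mem_union]
      exact ne_iff_lt_or_gt.trans or_comm
    · rw [Finset.disjoint_filter]
      intro k _ h; exact h.le.not_gt
  have hE : adjEnergy G = ∑ k with 0 < hA.eigenvalues k, hA.eigenvalues k
      - ∑ k with hA.eigenvalues k < 0, hA.eigenvalues k := by
    rw [adjEnergy, Finset.sum_filter, Finset.sum_filter, ← Finset.sum_sub_distrib]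
    refine Finset.sum_congr rfl fun k _ => ?_
    rcases lt_trichotomy (hA.eigenvalues k) 0 with h | h | h
    · simp [h, h.le.not_gt, abs_of_neg h]
    · simp [h]
    · simp [h, h.le.not_gt, abs_of_pos h]
  have h2' := mul_le_mul_of_nonneg_left h2 hα
  rw [← lapEnergy] at h2'
  rw [← aAlphaEnergy] at h1
  refine le_trans (le_of_eq ?_) (add_le_add h1 h2')
  simp_rw [dotProduct_aAlphaMatrix_eq_add, hq]
  rw [hE, hrank]
  simp only [Finset.sum_sub_distrib, Finset.sum_add_distrib, Finset.sum_const, nsmul_eq_mul,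
    ← Finset.mul_sum]
  ring

end GraphEnergy

/-! ### The equality case. -/

namespace GraphEnergy

open Matrix

variable {V : Type*} {G : SimpleGraph V}

theorem eq_of_forall_adj_eq (hG : G.Connected) {f : V → ℝ}
    (hf : ∀ i j, G.Adj i j → f i = f j) (i j : V) : f i = f j := by
  obtain ⟨p⟩ := hG i j
  induction p with
  | nil => rfl
  | cons h _ ih => exact (hf _ _ h).trans ih

variable [Fintype V] [DecidableRel G.Adj]

/-- A sign vector `s` with `∑ sᵢ = 0` and `A(G) = (J - s sᵀ) / 2`: a balanced complete
bipartition of `G`. -/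
structure IsBalancedSign (G : SimpleGraph V) [DecidableRel G.Adj] (s : V → ℝ) : Prop where
  sq : ∀ i, s i * s i = 1
  sum_eq_zero : ∑ i, s i = 0
  adj : ∀ i j, G.adjMatrix ℝ i j = (1 - s i * s j) / 2

theorem IsBalancedSign.exists_iso {s : V → ℝ} (hs : IsBalancedSign G s) :
    ∃ k : ℕ, Fintype.card V = 2 * k ∧
      Nonempty (G ≃g completeBipartiteGraph (Fin k) (Fin k)) := by
  have hpm : ∀ i, s i = 1 ∨ s i = -1 := fun i => mul_self_eq_one_iff.mp (hs.sq i)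
  have hcard : Fintype.card {i // s i = 1} = Fintype.card {i // ¬ s i = 1} := by
    have h := hs.sum_eq_zero
    rw [← Finset.sum_filter_add_sum_filter_not _ (fun i => s i = 1),
      Finset.sum_congr rfl (fun i hi => (Finset.mem_filter.mp hi).2),
      Finset.sum_congr (g := fun _ => (-1 : ℝ)) rfl
        (fun i hi => (hpm i).resolve_left (Finset.mem_filter.mp hi).2)] at h
    rw [Fintype.card_subtype, Fintype.card_subtype]
    simp only [Finset.sum_const, nsmul_eq_mul] at h
    have h' : ((Finset.card {i | s i = 1} : ℕ) : ℝ) = (Finset.card {i | ¬ s i = 1} : ℕ) := by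
      linarith
    exact_mod_cast h'
  let e : V ≃ Fin (Fintype.card {i // s i = 1}) ⊕ Fin (Fintype.card {i // s i = 1}) :=
    (Equiv.sumCompl (fun i => s i = 1)).symm.trans
      (Equiv.sumCongr (Fintype.equivFin _) (Fintype.equivFinOfCardEq hcard.symm))
  refine ⟨Fintype.card {i // s i = 1}, ?_, ⟨⟨e, ?_⟩⟩⟩
  · rw [Fintype.card_congr e]; simp [two_mul]
  · intro i j
    have hadj : G.Adj i j ↔ s i * s j = -1 := by
      have := hs.adj i j
      rw [SimpleGraph.adjMatrix_apply] at this
      split_ifs at this with h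
      · exact ⟨fun _ => by linarith, fun _ => h⟩
      · exact ⟨fun h' => absurd h' h, fun h' => by rw [h'] at this; norm_num at this⟩
    rw [hadj]
    have hl : ∀ i (h : s i = 1), e i = Sum.inl (Fintype.equivFin _ ⟨i, h⟩) := fun i h => by
      simp [e, Equiv.sumCompl_symm_apply_of_pos (p := fun i => s i = 1) h]
    have hr : ∀ i (h : ¬ s i = 1),
        e i = Sum.inr (Fintype.equivFinOfCardEq hcard.symm ⟨i, h⟩) := fun i h => by
      simp [e, Equiv.sumCompl_symm_apply_of_neg (p := fun i => s i = 1) h]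
    by_cases h1 : s i = 1 <;> by_cases h2 : s j = 1
    · rw [hl i h1, hl j h2, h1, h2]; norm_num
    · rw [hl i h1, hr j h2, h1, (hpm j).resolve_left h2]; simp
    · rw [hr i h1, hl j h2, h2, (hpm i).resolve_left h1]; simp
    · rw [hr i h1, hr j h2, (hpm i).resolve_left h1, (hpm j).resolve_left h2]; norm_num

theorem exists_isBalancedSign_of_iso {k : ℕ}
    (e : G ≃g completeBipartiteGraph (Fin k) (Fin k)) : ∃ s, IsBalancedSign G s := by
  refine ⟨fun i => Sum.elim (fun _ => 1) (fun _ => -1) (e i), fun i => ?_, ?_, fun i j => ?_⟩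
  · rcases e i with a | a <;> simp
  · exact (e.toEquiv.sum_comp (Sum.elim (fun _ => (1 : ℝ)) (fun _ => -1))).trans (by simp)
  · have h := e.map_adj_iff (v := i) (w := j)
    rw [SimpleGraph.adjMatrix_apply]
    rcases hi : e i with a | a <;> rcases hj : e j with b | b <;> rw [hi, hj] at h <;>
      simp at h <;> simp [h]

variable [DecidableEq V]

theorem adj_eq_of_dotProduct_lapMatrix_eq_zero {v : V → ℝ} (h : v ⬝ᵥ G.lapMatrix ℝ *ᵥ v = 0)
    (i j : V) (hij : G.Adj i j) : v i = v j :=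
  (G.lapMatrix_toLinearMap₂'_apply'_eq_zero_iff_forall_adj ℝ v).mp
    (by rw [toLinearMap₂'_apply', h]) i j hij

theorem adj_eq_neg_of_dotProduct_aAlphaMatrix_eq_zero {α : ℝ} (hα : 1 / 2 ≤ α) (hα' : α < 1)
    {v : V → ℝ} (h : v ⬝ᵥ aAlphaMatrix G α *ᵥ v = 0) (i j : V) (hij : G.Adj i j) :
    v i = -v j := by
  rw [dotProduct_aAlphaMatrix_mulVec] at h
  have h1 := mul_nonneg (by linarith : 0 ≤ 2 * α - 1) (sum_degree_mul_sq_nonneg G v)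
  have h2 := sum_sum_adj_sq_nonneg G v
  have h3 : (∑ i, ∑ j, if G.Adj i j then (v i + v j) ^ 2 else 0) = 0 := by nlinarith
  have hnn : ∀ i j, 0 ≤ if G.Adj i j then (v i + v j) ^ 2 else 0 := fun i j => by
    split_ifs <;> positivity
  rw [Finset.sum_eq_zero_iff_of_nonneg fun i _ => Finset.sum_nonneg fun j _ => hnn i j] at h3
  have h4 := h3 i (Finset.mem_univ i)
  rw [Finset.sum_eq_zero_iff_of_nonneg fun j _ => hnn i j] at h4
  have h5 := h4 j (Finset.mem_univ j)
  rw [if_pos hij] at h5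
  exact eq_neg_of_add_eq_zero_left (pow_eq_zero_iff two_ne_zero |>.mp h5)

/-- If `α > 1/2`, the degree-weighted sum of squares must vanish; connectedness makes every degree
positive, so `v = 0`. -/
theorem eq_half_of_dotProduct_aAlphaMatrix_eq_zero [Nontrivial V] (hG : G.Connected) {α : ℝ}
    (hα : 1 / 2 ≤ α) (hα' : α < 1) {v : V → ℝ} (hv : v ≠ 0)
    (h : v ⬝ᵥ aAlphaMatrix G α *ᵥ v = 0) : α = 1 / 2 := by
  by_contra hne
  have hlt : 0 < 2 * α - 1 := by
    have := lt_of_le_of_ne hα (Ne.symm hne)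
    linarith
  rw [dotProduct_aAlphaMatrix_mulVec] at h
  have h1 := sum_degree_mul_sq_nonneg G v
  have h2 := mul_nonneg (by linarith : 0 ≤ 1 - α) (sum_sum_adj_sq_nonneg G v)
  have h3 : ∑ i, (G.degree i : ℝ) * v i ^ 2 = 0 := by nlinarith
  rw [Finset.sum_eq_zero_iff_of_nonneg fun i _ => by positivity] at h3
  refine hv (funext fun i => ?_)
  have hd : (G.degree i : ℝ) ≠ 0 := by
    exact_mod_cast (hG.preconnected.degree_pos_of_nontrivial i).ne'
  simpa [hd] using h3 i (Finset.mem_univ i)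

theorem exists_isBalancedSign [Nontrivial V] (hG : G.Connected) {α : ℝ}
    (hα : 1 / 2 ≤ α) (hα' : α < 1)
    (hP : ∀ k, 0 < (isHermitian_adjMatrix G).eigenvalues k →
      (isHermitian_adjMatrix G).eigenvec k ⬝ᵥ
        G.lapMatrix ℝ *ᵥ (isHermitian_adjMatrix G).eigenvec k = 0)
    (hN : ∀ k, (isHermitian_adjMatrix G).eigenvalues k < 0 →
      (isHermitian_adjMatrix G).eigenvec k ⬝ᵥ
        aAlphaMatrix G α *ᵥ (isHermitian_adjMatrix G).eigenvec k = 0) :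
    α = 1 / 2 ∧ ∃ s, IsBalancedSign G s := by
  set hA := isHermitian_adjMatrix G
  obtain ⟨x⟩ := hG.nonempty
  obtain ⟨y, hxy⟩ : ∃ y, G.Adj x y := by
    have := hG.preconnected.degree_pos_of_nontrivial x
    exact (G.degree_pos_iff_exists_adj x).mp this
  -- Zero trace and a nonzero entry give eigenvalues of both signs.
  have htr : ∑ k, hA.eigenvalues k = 0 := by
    have := hA.trace_eq_sum_eigenvalues
    rw [SimpleGraph.trace_adjMatrix] at this
    simpa using this.symm
  have hne : ∃ k, hA.eigenvalues k ≠ 0 := by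
    by_contra! h
    have := hA.apply_eq_sum_eigenvalues x y
    simp [h, hxy] at this
  obtain ⟨p, hp⟩ : ∃ p, 0 < hA.eigenvalues p := by
    obtain ⟨k, hk⟩ := hne
    obtain ⟨p, -, hp⟩ := Finset.exists_pos_of_sum_zero_of_exists_nonzero _ htr
      ⟨k, Finset.mem_univ k, hk⟩
    exact ⟨p, hp⟩
  obtain ⟨q, hq⟩ : ∃ q, hA.eigenvalues q < 0 := by
    by_contra! h
    exact hp.ne' ((Finset.sum_eq_zero_iff_of_nonneg fun k _ => h k).mp htr p (Finset.mem_univ p))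
  refine ⟨eq_half_of_dotProduct_aAlphaMatrix_eq_zero hG hα hα'
    (hA.eigenvec_ne_zero q) (hN q hq), ?_⟩
  have hn0 : (Fintype.card V : ℝ) ≠ 0 := by
    have : 0 < Fintype.card V := Fintype.card_pos_iff.mpr ⟨x⟩
    exact_mod_cast this.ne'
  have hconst : ∀ k, 0 < hA.eigenvalues k → ∀ i j, hA.eigenvec k i = hA.eigenvec k j :=
    fun k hk => eq_of_forall_adj_eq hG (adj_eq_of_dotProduct_lapMatrix_eq_zero (hP k hk))
  have hneg : ∀ k, hA.eigenvalues k < 0 → ∀ i j, G.Adj i j →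
      hA.eigenvec k i = -hA.eigenvec k j :=
    fun k hk => adj_eq_neg_of_dotProduct_aAlphaMatrix_eq_zero hα hα' (hN k hk)
  -- Both factors change sign across an edge, so their product is constant on the connected graph.
  have hprod : ∀ k, hA.eigenvalues k < 0 → ∀ i j, hA.eigenvec k i * hA.eigenvec q i
      = hA.eigenvec k j * hA.eigenvec q j := fun k hk =>
    eq_of_forall_adj_eq hG fun i j hij => by rw [hneg k hk i j hij, hneg q hq i j hij]; ring
  have hunit : ∀ k, (∀ i j, hA.eigenvec k i * hA.eigenvec k i
      = hA.eigenvec k j * hA.eigenvec k j) →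
      ∀ i, hA.eigenvec k i * hA.eigenvec k i = 1 / Fintype.card V := by
    intro k hk i
    have := hA.eigenvec_dotProduct k k
    rw [if_pos rfl, dotProduct, Finset.sum_congr rfl fun j _ => hk j i] at this
    rw [eq_div_iff hn0, mul_comm]
    simpa using this
  have hqq := hunit q (hprod q hq)
  set r := hA.eigenvec q x with hr
  have hr0 : r ≠ 0 := by
    intro h0
    have := hqq x
    rw [← hr, h0] at this
    simp [eq_comm, hn0] at this
  have hrr : r * r = 1 / Fintype.card V := hqq x
  let s : V → ℝ := fun i => hA.eigenvec q i / r
  have hs : ∀ i, s i * s i = 1 := fun i => by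
    simp only [s, div_mul_div_comm, hqq, hrr]
    exact div_self (one_div_ne_zero hn0)
  have hsadj : ∀ i j, G.Adj i j → s i * s j = -1 := fun i j hij => by
    have h1 : s i = -s j := by simp only [s]; rw [hneg q hq i j hij, neg_div]
    rw [h1, neg_mul, hs]
  -- Every negative eigenvector has the projection `s sᵀ / n`, so only the sum of the negative
  -- eigenvalues matters, not their number.
  have hmul : ∀ k, hA.eigenvalues k < 0 → ∀ i j,
      hA.eigenvec k i * hA.eigenvec k j = 1 / Fintype.card V * (s i * s j) := by
    intro k hk
    have hks : ∀ i, hA.eigenvec k i = hA.eigenvec k x * s i := fun i => by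
      have h1 : hA.eigenvec k i * s i = hA.eigenvec k x := by
        simp only [s]
        rw [← mul_div_assoc, hprod k hk i x, mul_div_assoc, div_self hr0, mul_one]
      rw [← h1, mul_assoc, hs, mul_one]
    have hkx := hunit k (fun i j => by
      rw [hks i, hks j, mul_mul_mul_comm, hs, mul_mul_mul_comm _ (s j), hs]) x
    intro i j
    rw [hks i, hks j, mul_mul_mul_comm, hkx]
  set g := ∑ k with 0 < hA.eigenvalues k, hA.eigenvalues k
  have hsplit : ∀ f : V → ℝ, ∑ k, hA.eigenvalues k * f k
      = ∑ k with 0 < hA.eigenvalues k, hA.eigenvalues k * f k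
        + ∑ k with hA.eigenvalues k < 0, hA.eigenvalues k * f k := by
    intro f
    rw [Finset.sum_filter, Finset.sum_filter, ← Finset.sum_add_distrib]
    refine Finset.sum_congr rfl fun k _ => ?_
    rcases lt_trichotomy (hA.eigenvalues k) 0 with h | h | h
    · simp [h, h.le.not_gt]
    · simp [h]
    · simp [h, h.le.not_gt]
  have hg : ∑ k with hA.eigenvalues k < 0, hA.eigenvalues k = -g := by
    have := hsplit fun _ => 1
    simp only [mul_one] at this
    rw [htr] at this
    linarith
  have hentry : ∀ i j, G.adjMatrix ℝ i j = g / Fintype.card V * (1 - s i * s j) := by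
    intro i j
    rw [hA.apply_eq_sum_eigenvalues i j, hsplit fun k => hA.eigenvec k i * hA.eigenvec k j]
    have h1 : ∑ k with 0 < hA.eigenvalues k, hA.eigenvalues k * (hA.eigenvec k i * hA.eigenvec k j)
        = g * (1 / Fintype.card V) := by
      rw [Finset.sum_mul]
      refine Finset.sum_congr rfl fun k hk => ?_
      have hk' := (Finset.mem_filter.mp hk).2
      rw [hconst k hk' j i, hunit k fun i j => by rw [hconst k hk' i j]]
    have h2 : ∑ k with hA.eigenvalues k < 0, hA.eigenvalues k * (hA.eigenvec k i * hA.eigenvec k j)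
        = -g * (1 / Fintype.card V * (s i * s j)) := by
      rw [← hg, Finset.sum_mul]
      refine Finset.sum_congr rfl fun k hk => ?_
      rw [hmul k (Finset.mem_filter.mp hk).2]
    rw [h1, h2]; ring
  -- Read off from the edge `xy`: entry `1`, with `s x * s y = -1`.
  have hgn : g / Fintype.card V = 1 / 2 := by
    have := hentry x y
    rw [SimpleGraph.adjMatrix_apply, if_pos hxy, hsadj x y hxy] at this
    linarith
  refine ⟨s, hs, ?_, fun i j => by rw [hentry, hgn]; ring⟩
  -- Balance of `s` is orthogonality of `q` to the constant eigenvector `p`.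
  have horth := hA.eigenvec_dotProduct p q
  have hpq : p ≠ q := by rintro rfl; exact hp.not_gt hq
  rw [if_neg hpq, dotProduct, Finset.sum_congr rfl fun i _ => by rw [hconst p hp i x],
    ← Finset.mul_sum] at horth
  have hpx : hA.eigenvec p x ≠ 0 := by
    intro h0
    have := hunit p (fun i j => by rw [hconst p hp i j]) x
    rw [h0] at this
    simp [eq_comm, hn0] at this
  simp only [s]
  rw [← Finset.sum_div, (mul_eq_zero.mp horth).resolve_left hpx, zero_div]

/-- The graph is `n/2`-regular, so `D` is scalar: `L - n/2 = -A` and `A_{1/2} - n/4 = A/2`. With `tr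
A² = n²/2`, the energies of `A`, `L`, `A_{1/2}` are `n`, `n`, `n/2` and the rank is `2`. -/
theorem IsBalancedSign.energy_eq [Nonempty V] {s : V → ℝ} (hs : IsBalancedSign G s) :
    aAlphaEnergy G (1 / 2) + 1 / 2 * lapEnergy G = 2 * adjEnergy G
      - 4 * (1 / 2) * (G.edgeFinset.card : ℝ) * ((G.adjMatrix ℝ).rank : ℝ)
          / (Fintype.card V : ℝ) := by
  set n : ℝ := (Fintype.card V : ℝ) with hn
  have hn0 : 0 < n := by simp [hn, Fintype.card_pos]
  have hsq : ∑ i, s i * s i = n := by simp [hs.sq, hn]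
  have hdeg : ∀ i, (G.degree i : ℝ) = n / 2 := by
    intro i
    rw [G.degree_eq_sum_if_adj]
    have : ∀ j, (if G.Adj i j then (1 : ℝ) else 0) = (1 - s i * s j) / 2 := fun j => by
      rw [← hs.adj, SimpleGraph.adjMatrix_apply]
    simp_rw [this]
    rw [← Finset.sum_div, Finset.sum_sub_distrib, ← Finset.mul_sum, hs.sum_eq_zero]
    simp [hn]
  have hm : 2 * (G.edgeFinset.card : ℝ) = n * (n / 2) := by
    rw [← trace_degMatrix, SimpleGraph.degMatrix, trace_diagonal]
    simp [hdeg, hn]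
  have hD : G.degMatrix ℝ = (n / 2) • (1 : Matrix V V ℝ) := by
    rw [SimpleGraph.degMatrix, smul_one_eq_diagonal]
    simp_rw [hdeg]
  have hA2 : ∀ i j, (G.adjMatrix ℝ * G.adjMatrix ℝ) i j = n / 4 * (1 + s i * s j) := by
    intro i j
    rw [mul_apply]
    simp_rw [hs.adj]
    have : ∀ l, (1 - s i * s l) / 2 * ((1 - s l * s j) / 2)
        = 1 / 4 - s i / 4 * s l - s j / 4 * s l + s i * s j / 4 * (s l * s l) := fun l => by ring
    simp_rw [this]
    rw [Finset.sum_add_distrib, Finset.sum_sub_distrib, Finset.sum_sub_distrib, ← Finset.mul_sum,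
      ← Finset.mul_sum, ← Finset.mul_sum, hs.sum_eq_zero, hsq, Finset.sum_const, nsmul_eq_mul,
      Finset.card_univ, ← hn]
    ring
  have hA3 : G.adjMatrix ℝ * (G.adjMatrix ℝ * G.adjMatrix ℝ) = (n / 2) ^ 2 • G.adjMatrix ℝ := by
    ext i j
    rw [mul_apply]
    simp_rw [hA2, Matrix.smul_apply, hs.adj]
    have : ∀ l, (1 - s i * s l) / 2 * (n / 4 * (1 + s l * s j))
        = n / 8 - n / 8 * s i * s l + n / 8 * s j * s l - n / 8 * s i * s j * (s l * s l) :=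
      fun l => by ring
    simp_rw [this]
    rw [Finset.sum_sub_distrib, Finset.sum_add_distrib, Finset.sum_sub_distrib, ← Finset.mul_sum,
      ← Finset.mul_sum, ← Finset.mul_sum, hs.sum_eq_zero, hsq, Finset.sum_const, nsmul_eq_mul,
      Finset.card_univ, ← hn, smul_eq_mul]
    ring
  have htr : (G.adjMatrix ℝ * G.adjMatrix ℝ).trace = n ^ 2 / 2 := by
    simp only [trace, diag_apply, hA2, hs.sq, Finset.sum_const, nsmul_eq_mul, Finset.card_univ,
      ← hn]
    ring
  have hEA : adjEnergy G = n := by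
    have := (isHermitian_adjMatrix G).sum_abs_eigenvalues_sub (c := 0) (half_pos hn0)
      (by simpa using hA3)
    simp only [sub_zero, zero_smul, htr] at this
    rw [adjEnergy, this]
    field_simp
  have hrank : ((G.adjMatrix ℝ).rank : ℝ) = 2 := by
    rw [(isHermitian_adjMatrix G).rank_eq_trace_sq_div (half_pos hn0) hA3, htr]
    field_simp
  have hEL : lapEnergy G = n := by
    have hc : 2 * (G.edgeFinset.card : ℝ) / n = n / 2 := by rw [hm]; field_simp
    have hL : G.lapMatrix ℝ - (n / 2) • (1 : Matrix V V ℝ) = -G.adjMatrix ℝ := by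
      rw [SimpleGraph.lapMatrix, hD]; abel
    have := (isHermitian_lapMatrix G).sum_abs_eigenvalues_sub (c := n / 2) (half_pos hn0)
      (by rw [hL]; simp [hA3])
    rw [hL, neg_mul_neg, htr] at this
    rw [lapEnergy, ← hn, hc, this]
    field_simp
  have hEα : aAlphaEnergy G (1 / 2) = n / 2 := by
    have hc : 2 * (1 / 2) * (G.edgeFinset.card : ℝ) / n = n / 4 := by
      rw [show 2 * (1 / 2) * (G.edgeFinset.card : ℝ) = n * (n / 2) / 2 by linarith]
      field_simp; norm_num
    have hL : aAlphaMatrix G (1 / 2) - (n / 4) • (1 : Matrix V V ℝ)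
        = (1 / 2 : ℝ) • G.adjMatrix ℝ := by
      rw [aAlphaMatrix, hD, smul_smul]
      rw [show (1 / 2 : ℝ) * (n / 2) = n / 4 by ring, show (1 - 1 / 2 : ℝ) = 1 / 2 by norm_num]
      abel
    have := (isHermitian_aAlphaMatrix G (1 / 2)).sum_abs_eigenvalues_sub (c := n / 4) (t := n / 4)
      (by positivity) (by
        rw [hL]
        simp only [smul_mul_assoc, mul_smul_comm, hA3, smul_smul]
        congr 1; ring)
    rw [hL, smul_mul_assoc, mul_smul_comm, smul_smul, trace_smul, htr] at this
    rw [aAlphaEnergy, ← hn, hc, this, smul_eq_mul]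
    field_simp; norm_num
  rw [hEA, hEL, hEα, hrank,
    show 4 * (1 / 2) * (G.edgeFinset.card : ℝ) * 2 / n = n by
      rw [show 4 * (1 / 2) * (G.edgeFinset.card : ℝ) * 2 = n * n by linarith]; field_simp]
  ring

end GraphEnergy

/-! ### The main theorem. -/

theorem theorem5p1 {V : Type*} [Fintype V] [DecidableEq V] (G : SimpleGraph V)
    [DecidableRel G.Adj] (hG : G.Connected) (hn : 2 ≤ Fintype.card V)
    (α : ℝ) (hα : 1 / 2 ≤ α) (hα' : α < 1) :
    GraphEnergy.aAlphaEnergy G α + α * GraphEnergy.lapEnergy G ≥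
        2 * GraphEnergy.adjEnergy G
          - 4 * α * (G.edgeFinset.card : ℝ) * ((G.adjMatrix ℝ).rank : ℝ)
              / (Fintype.card V : ℝ) ∧
      (GraphEnergy.aAlphaEnergy G α + α * GraphEnergy.lapEnergy G =
          2 * GraphEnergy.adjEnergy G
            - 4 * α * (G.edgeFinset.card : ℝ) * ((G.adjMatrix ℝ).rank : ℝ)
                / (Fintype.card V : ℝ) ↔
        α = 1 / 2 ∧ ∃ k : ℕ, Fintype.card V = 2 * k ∧
          Nonempty (G ≃g completeBipartiteGraph (Fin k) (Fin k))) := by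
  have : Nontrivial V := Fintype.one_lt_card_iff_nontrivial.mp hn
  have hα0 : 0 < α := by linarith
  have hmain := GraphEnergy.two_mul_adjEnergy_add_le G hα0.le
  set hA := GraphEnergy.isHermitian_adjMatrix G
  have hLnn : ∀ k ∈ ({k | 0 < hA.eigenvalues k} : Finset V), (0 : ℝ) ≤ _ := fun k _ =>
    GraphEnergy.dotProduct_lapMatrix_mulVec_nonneg G (hA.eigenvec k)
  have hAnn : ∀ k ∈ ({k | hA.eigenvalues k < 0} : Finset V), (0 : ℝ) ≤ _ := fun k _ =>
    GraphEnergy.dotProduct_aAlphaMatrix_mulVec_nonneg G hα hα' (hA.eigenvec k)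
  have h1 := mul_nonneg (mul_nonneg two_pos.le hα0.le) (Finset.sum_nonneg hLnn)
  have h2 := mul_nonneg (two_pos (α := ℝ)).le (Finset.sum_nonneg hAnn)
  refine ⟨by linarith, fun heq => ?_, ?_⟩
  · rw [heq] at hmain
    -- Under equality the two nonnegative discarded terms have sum at most zero, so each vanishes,
    -- and then each summand does.
    have h1' := le_antisymm (by linarith) h1
    have h2' := le_antisymm (by linarith) h2
    rw [mul_eq_zero, or_iff_right (by positivity),
      Finset.sum_eq_zero_iff_of_nonneg hLnn] at h1'
    rw [mul_eq_zero, or_iff_right two_ne_zero,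
      Finset.sum_eq_zero_iff_of_nonneg hAnn] at h2'
    obtain ⟨hhalf, s, hs⟩ := GraphEnergy.exists_isBalancedSign hG hα hα'
      (fun k hk => h1' k (by simpa using hk)) (fun k hk => h2' k (by simpa using hk))
    exact ⟨hhalf, hs.exists_iso⟩
  · rintro ⟨rfl, k, -, ⟨e⟩⟩
    obtain ⟨s, hs⟩ := GraphEnergy.exists_isBalancedSign_of_iso e
    exact hs.energy_eq
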